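/- **Setting.** Let $n,m,k\ge 0$, $m_0=1$ and $m_1,\dots,m_k\ge 0$ be integers, $\mathcal X\subseteq\mathbb R^m$, and let $\mathcal P(\mathcal X)$ be the set of Borel probability measures on $\mathcal X$. Norms are Euclidean. Let $U\subseteq\mathbb R^n$ be closed, and let $$f_j:\mathbb R^n\times\mathbb R^{m_j}\times\mathbb R^m\to\mathbb R^{m_{j-1}}\ (1\le j\le k),\qquad f_{k+1}:\mathbb R^n\times\mathbb R^m\to\mathbb R^{m_k}$$ be such that $(u,\eta)\mapsto f_j(u,\eta,x)$ and $u\mapsto f_{k+1}(u,x)$ are continuous for every $x\in\mathcal X$. For $Q\in\mathcal P(\mathcal X)$ put $\bar f_j^{Q}(u,\eta)=\int_{\mathcal X} f_j(u,\eta,x)\,Q(dx)$ and $\bar f_{k+1}^{Q}(u)=\int_{\mathcal X} f_{k+1}(u,x)\,Q(dx)$ (an integral that does not exist is read as $0$). For $\mathbf Q=(Q^1,\dots,Q^{k+1})\in\mathcal P(\mathcal X)^{k+1}$ put $$\varrho^{\mathbf Q}[u]=\bar f_1^{Q^1}\Big(u,\bar f_2^{Q^2}\big(u,\cdots \bar f_k^{Q^k}(u,\bar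 f_{k+1}^{Q^{k+1}}(u))\cdots\big)\Big),\qquad \vartheta^{\mathbf Q}=\min_{u\in U}\varrho^{\mathbf Q}[u],$$ and let $S^{\mathbf Q}$ be the set of minimizers of $\varrho^{\mathbf Q}$ over $U$. Let $P\in\mathcal P(\mathcal X)$ be such that $f_j(u,\eta,\cdot)$ and $f_{k+1}(u,\cdot)$ are $P$-integrable for all $u\in U$ and all $\eta$, and write $\varrho,\vartheta,S$ for the objects with $Q^1=\dots=Q^{k+1}=P$. Assume that $S\neq\emptyset$. Fix a compact set $\mathcal U$ with $S\subseteq\mathcal U\subseteq U$ and compact sets $I_j\subset\mathbb R^{m_j}$ $(1\le j\le k)$ with $\bar f_{j+1}^P(\mathcal U\times I_{j+1})\subseteq \operatorname{int} I_j$ for $1\le j\le k-1$ and, if $k\ge1$, $\bar f_{k+1}^P(\mathcal U)\subseteq\operatorname{int} I_k$. For $A,B\subseteq\mathbb R^n$ let $d(A,B)=\sup_{x\in A}\inf_{y\in B}\|x-y\|$ and $D(A,B)=\max\{d(A,B),d(B,A)\}$, with values in $[0,\infty]$. **Theorem.** For each $j=1,\dots,k+1$ let $(Q_N^j)_{N\in\mathbb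 N}$ be a sequence in $\mathcal P(\mathcal X)$ with $Q_N^j\to P$ weakly, write $\mathbf Q_N=(Q_N^1,\dots,Q_N^{k+1})$, and assume that $\emptyset\neq S^{\mathbf Q_N}\subseteq\mathcal U$ for all sufficiently large $N$. Suppose that one of the following holds, where $\overline{\mathrm{co}}\,\mathcal X$ is the closed convex hull of $\mathcal X$. (a) For all $u\in\mathcal U$ and $\eta_j\in I_j$, every component $g$ of $f_j(u,\eta_j,\cdot)$, $1\le j\le k$, and of $f_{k+1}(u,\cdot)$ satisfies $|g(x)-g(x')|\le\|x-x'\|$ and $|g(x)|\le1$ for all $x,x'\in\overline{\mathrm{co}}\,\mathcal X$. (b) There are functions $w_{j,i}:[0,\infty)\to[0,\infty)$, one for each component $i$ of each $f_j$, $1\le j\le k+1$, with $\lim_{t\downarrow0}w_{j,i}(t)=w_{j,i}(0)=0$, such that for all $u\in\mathcal U$ and $\eta_j\in I_j$ the $i$-th component $g$ of $f_j(u,\eta_j,\cdot)$ (of $f_{k+1}(u,\cdot)$ if $j=k+1$) satisfies $|g(x)-g(x')|\le w_{j,i}(\|x-x'\|)$ for all $x,x'\in\overline{\mathrm{co}}\,\mathcal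 X$. Moreover, $\int_{\mathcal X}\|x\|\,Q_N^j(dx)$ and $\int_{\mathcal X}\|x\|\,P(dx)$ are finite for all $N$ and $j$, and $\lim_{N\to\infty}\int_{\mathcal X}\|x\|\,Q_N^j(dx)=\int_{\mathcal X}\|x\|\,P(dx)$ for every $j$. Then, as $N\to\infty$, $\varrho^{\mathbf Q_N}[u]\to\varrho[u]$ for every $u\in\mathcal U$, $\vartheta^{\mathbf Q_N}\to\vartheta$, and $d(S^{\mathbf Q_N},S)\to0$. If, additionally, $S$ consists of a single point, then $D(S^{\mathbf Q_N},S)\to0$. -/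

import Mathlib

open MeasureTheory Filter Topology Set
open scoped NNReal ENNReal

noncomputable section

/-- `ℝᵈ` with its Euclidean norm. -/
abbrev Euc (d : ℕ) : Type := EuclideanSpace ℝ (Fin d)

/-- The data of a composite optimization problem with `k + 1` levels of nesting: the dimensions
`m₀ = 1, m₁, …, m_k`, the functions `f₁, …, f_k` (here `f 0, …, f (k - 1)`), the innermost function
`f_{k+1}` (here `fLast`), the feasible set `U ⊆ ℝⁿ` and the set `𝒳 ⊆ ℝᵐ` of realizations. -/
structure CompositeProblem (n m k : ℕ) where
  dim : Fin (k + 1) → ℕ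
  dim_zero : dim 0 = 1
  f : (j : Fin k) → Euc n → Euc (dim j.succ) → Euc m → Euc (dim j.castSucc)
  fLast : Euc n → Euc m → Euc (dim (Fin.last k))
  U : Set (Euc n)
  X : Set (Euc m)

namespace CompositeProblem

variable {n m k : ℕ} (C : CompositeProblem n m k)

/-- `f̄_j^Q(u, η) = ∫_𝒳 f_j(u, η, x) Q(dx)` for the outer levels. -/
def fBar (j : Fin k) (Q : ProbabilityMeasure C.X) (u : Euc n) (η : Euc (C.dim j.succ)) :
    Euc (C.dim j.castSucc) :=
  ∫ x : C.X, C.f j u η (x : Euc m) ∂(Q : Measure C.X)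

/-- `f̄_{k+1}^Q(u) = ∫_𝒳 f_{k+1}(u, x) Q(dx)` for the innermost level. -/
def fBarLast (Q : ProbabilityMeasure C.X) (u : Euc n) : Euc (C.dim (Fin.last k)) :=
  ∫ x : C.X, C.fLast u (x : Euc m) ∂(Q : Measure C.X)

/-- The value of the nested expression at level `j`, computed from the innermost level outwards:
it is `f̄_{k+1}(u)` at the last level and `f̄_j(u, ·)` applied to the value of the next inner level
otherwise. The function at each level is integrated with respect to the measure of that level. -/
def levelValue (Q : Fin (k + 1) → ProbabilityMeasure C.X) (u : Euc n) (j : Fin (k + 1)) :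
    Euc (C.dim j) :=
  Fin.reverseInduction (motive := fun j => Euc (C.dim j))
    (C.fBarLast (Q (Fin.last k)) u)
    (fun j η => C.fBar j (Q j.castSucc) u η) j

/-- The composite functional
`ϱ^{(Q¹,…,Q^{k+1})}[u] = f̄₁^{Q¹}(u, f̄₂^{Q²}(u, ⋯ f̄_k^{Q^k}(u, f̄_{k+1}^{Q^{k+1}}(u)) ⋯ ))`. -/
def rho (Q : Fin (k + 1) → ProbabilityMeasure C.X) (u : Euc n) : ℝ :=
  C.levelValue Q u 0 ⟨0, by rw [C.dim_zero]; exact Nat.one_pos⟩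

/-- The set of optimal solutions of `min_{u ∈ U} ϱ^{(Q¹,…,Q^{k+1})}[u]`. -/
def solutionSet (Q : Fin (k + 1) → ProbabilityMeasure C.X) : Set (Euc n) :=
  {u | u ∈ C.U ∧ ∀ v ∈ C.U, C.rho Q u ≤ C.rho Q v}

/-- The optimal value `ϑ^{(Q¹,…,Q^{k+1})}`; it is used only for problems that have a solution,
and then it is the minimum, see `optimalValue_isLeast`. -/
def optimalValue (Q : Fin (k + 1) → ProbabilityMeasure C.X) : ℝ :=
  sInf (C.rho Q '' C.U)

theorem optimalValue_isLeast (Q : Fin (k + 1) → ProbabilityMeasure C.X)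
    (h : (C.solutionSet Q).Nonempty) : IsLeast (C.rho Q '' C.U) (C.optimalValue Q) := by
  obtain ⟨u, hu, hmin⟩ := h
  have hl : IsLeast (C.rho Q '' C.U) (C.rho Q u) := by
    refine ⟨⟨u, hu, rfl⟩, ?_⟩
    rintro _ ⟨v, hv, rfl⟩
    exact hmin v hv
  have he : C.optimalValue Q = C.rho Q u := hl.csInf_eq
  rw [he]
  exact hl

end CompositeProblem

/-- The closed convex hull of `X`. -/
abbrev closedHull {m : ℕ} (X : Set (Euc m)) : Set (Euc m) := closure (convexHull ℝ X)

/-- The class `𝔽` of real functions on the closed convex hull of `X` that are Lipschitz continuous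
with constant one and bounded in absolute value by one. -/
def boundedLipschitzClass {m : ℕ} (X : Set (Euc m)) : Set (closedHull X → ℝ) :=
  {g | (∀ x x', |g x - g x'| ≤ ‖(x : Euc m) - (x' : Euc m)‖) ∧ ∀ x, |g x| ≤ 1}

/-- A modulus of continuity: `w : ℝ₊ → ℝ₊` with `lim_{t ↓ 0} w(t) = w(0) = 0`. -/
def IsModulus (w : ℝ≥0 → ℝ≥0) : Prop :=
  w 0 = 0 ∧ Tendsto w (𝓝[>] 0) (𝓝 0)

/-- The real functions on the closed convex hull of `X` that admit `w` as a modulus of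
continuity. -/
def modulusClass {m : ℕ} (X : Set (Euc m)) (w : ℝ≥0 → ℝ≥0) : Set (closedHull X → ℝ) :=
  {g | ∀ x x', |g x - g x'| ≤ w ‖(x : Euc m) - (x' : Euc m)‖₊}

/-- The one-sided distance `sup_{x ∈ A} inf_{y ∈ B} ‖x - y‖`, with values in `[0, ∞]`. -/
def oneSidedDist {n : ℕ} (A B : Set (Euc n)) : ℝ≥0∞ :=
  ⨆ x ∈ A, ⨅ y ∈ B, edist x y

/-- The Pompeiu–Hausdorff distance. -/
def pompeiuHausdorffDist {n : ℕ} (A B : Set (Euc n)) : ℝ≥0∞ :=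
  max (oneSidedDist A B) (oneSidedDist B A)

namespace CompositeProblem

variable {n m k : ℕ} (C : CompositeProblem n m k)

/-- Standing assumptions on the problem and on the measure `P`: `U` is closed, the functions
`f_j(·, ·, x)`, `f_{k+1}(·, x)` are continuous, `f_j(u, η, ·)`, `f_{k+1}(u, ·)` are `P`-integrable,
and the problem for `P` has a solution. -/
structure StandingAssumptions (P : ProbabilityMeasure C.X) : Prop where
  isClosed : IsClosed C.U
  continuous_f : ∀ j, ∀ x ∈ C.X,
    Continuous fun p : Euc n × Euc (C.dim j.succ) => C.f j p.1 p.2 x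
  continuous_fLast : ∀ x ∈ C.X, Continuous fun u : Euc n => C.fLast u x
  integrable_f : ∀ j, ∀ u ∈ C.U, ∀ η,
    Integrable (fun x : C.X => C.f j u η (x : Euc m)) (P : Measure C.X)
  integrable_fLast : ∀ u ∈ C.U,
    Integrable (fun x : C.X => C.fLast u (x : Euc m)) (P : Measure C.X)
  nonempty_solutionSet : (C.solutionSet fun _ => P).Nonempty

/-- The choice of the compact sets `𝒰` and `I₁, …, I_k`: `S ⊆ 𝒰 ⊆ U`,
`f̄_{j+1}^P(𝒰, I_{j+1}) ⊆ int I_j` for `1 ≤ j < k`, and `f̄_{k+1}^P(𝒰) ⊆ int I_k`.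
The set `I 0` plays no role: nothing is required of it. -/
structure IsLocalization (P : ProbabilityMeasure C.X) (Uc : Set (Euc n))
    (I : (j : Fin (k + 1)) → Set (Euc (C.dim j))) : Prop where
  isCompact : IsCompact Uc
  solutionSet_subset : (C.solutionSet fun _ => P) ⊆ Uc
  subset_U : Uc ⊆ C.U
  isCompact_I : ∀ j, j ≠ 0 → IsCompact (I j)
  fBar_mem : ∀ j : Fin k, j.castSucc ≠ 0 → ∀ u ∈ Uc, ∀ η ∈ I j.succ,
    C.fBar j P u η ∈ interior (I j.castSucc)
  fBarLast_mem : Fin.last k ≠ 0 → ∀ u ∈ Uc, C.fBarLast P u ∈ interior (I (Fin.last k))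

/-- Condition (a): all components of `f_j(u, η_j, ·)` and `f_{k+1}(u, ·)` are in `𝔽`, for
`u ∈ 𝒰` and `η_j ∈ I_j`. -/
def BoundedLipschitzCondition (Uc : Set (Euc n))
    (I : (j : Fin (k + 1)) → Set (Euc (C.dim j))) : Prop :=
  (∀ j : Fin k, ∀ u ∈ Uc, ∀ η ∈ I j.succ, ∀ i,
    (fun x : closedHull C.X => C.f j u η (x : Euc m) i) ∈ boundedLipschitzClass C.X) ∧
  (∀ u ∈ Uc, ∀ i,
    (fun x : closedHull C.X => C.fLast u (x : Euc m) i) ∈ boundedLipschitzClass C.X)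

/-- The components of `f_j(u, η_j, ·)` and `f_{k+1}(u, ·)` admit the given moduli of continuity
(one for each component of each level), for all `u ∈ 𝒰` and `η_j ∈ I_j`. -/
def ModulusCondition (Uc : Set (Euc n)) (I : (j : Fin (k + 1)) → Set (Euc (C.dim j)))
    (w : (j : Fin (k + 1)) → Fin (C.dim j) → ℝ≥0 → ℝ≥0) : Prop :=
  (∀ j : Fin k, ∀ u ∈ Uc, ∀ η ∈ I j.succ, ∀ i,
    (fun x : closedHull C.X => C.f j u η (x : Euc m) i) ∈
      modulusClass C.X (w j.castSucc i)) ∧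
  (∀ u ∈ Uc, ∀ i,
    (fun x : closedHull C.X => C.fLast u (x : Euc m) i) ∈
      modulusClass C.X (w (Fin.last k) i))

/-- The first absolute moments of the measures `Q_N^j` and `P` are finite, and those of `Q_N^j`
converge to that of `P` for every `j`. -/
def FirstMomentsConverge (P : ProbabilityMeasure C.X)
    (Q : ℕ → Fin (k + 1) → ProbabilityMeasure C.X) : Prop :=
  Integrable (fun x : C.X => ‖(x : Euc m)‖) (P : Measure C.X) ∧
  (∀ N j, Integrable (fun x : C.X => ‖(x : Euc m)‖) (Q N j : Measure C.X)) ∧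
  ∀ j, Tendsto (fun N => ∫ x : C.X, ‖(x : Euc m)‖ ∂(Q N j : Measure C.X)) atTop
    (𝓝 (∫ x : C.X, ‖(x : Euc m)‖ ∂(P : Measure C.X)))

end CompositeProblem

end

/-!
The whole proof rests on continuous convergence of `ϱ^{𝐐_N}`: if `u_N → u` in `𝒰`, then
`ϱ^{𝐐_N}[u_N] → ϱ[u]`. The values of the nested expression at all levels converge, by induction
from the innermost level outwards (`CompositeProblem.tendsto_levelValue`). In the induction step
one needs the joint continuity of `(p, ξ) ↦ ∫ F p dξ`, where `p = (u, η)` runs over `𝒰 × I_j`.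

No uniformity over function classes is needed for this joint continuity
(`IsDominatedFamily.tendsto_integral`): `∫ F p dξ` is the integral of the single function
`(p, x) ↦ F p x` with respect to `δ_p ⊗ ξ`, and `δ_{p_N} ⊗ ξ_N → δ_p ⊗ ξ` weakly if `p_N → p` and
`ξ_N → ξ`. The common modulus of continuity in `x` makes `F` jointly continuous. Under condition
(a) it is bounded. Under condition (b) it is dominated by `A + B ‖x‖`, because a function with a
modulus of continuity on a convex set grows at most linearly, and the convergence of first moments
then replaces boundedness (`tendsto_integral_of_dominated`).

Convergence of optimal values and of solution sets follows from continuous convergence and the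
compactness of `𝒰`. All limits are taken along arbitrary filters, so that continuous convergence
at `u` is convergence along the product of `atTop` and `𝓝[𝒰] u`.
-/

/-! ### Weak convergence and dominated continuous functions -/

/-- Lower semicontinuity of the integral of a nonnegative continuous function under weak
convergence, along an arbitrary filter. -/
theorem eventually_lt_integral_of_tendsto {Y ι : Type*} [TopologicalSpace Y] [MeasurableSpace Y]
    [OpensMeasurableSpace Y] {l : Filter ι} {μ : ι → ProbabilityMeasure Y}
    {ν : ProbabilityMeasure Y} (hμ : Tendsto μ l (𝓝 ν)) {G : Y → ℝ} (hG : Continuous G)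
    (hG0 : ∀ y, 0 ≤ G y) (hGμ : ∀ i, Integrable G (μ i : Measure Y))
    (hGν : Integrable G (ν : Measure Y)) {a : ℝ} (ha : a < ∫ y, G y ∂(ν : Measure Y)) :
    ∀ᶠ i in l, a < ∫ y, G y ∂(μ i : Measure Y) := by
  have htrunc : Tendsto (fun M : ℕ => ∫ y, min (G y) M ∂(ν : Measure Y)) atTop
      (𝓝 (∫ y, G y ∂(ν : Measure Y))) := by
    refine tendsto_integral_of_dominated_convergence G
      (fun M => (hG.min continuous_const).measurable.aestronglyMeasurable) hGν
      (fun M => Eventually.of_forall fun y => ?_) (Eventually.of_forall fun y => ?_)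
    · rw [Real.norm_of_nonneg (le_min (hG0 y) M.cast_nonneg)]
      exact min_le_left _ _
    · refine tendsto_const_nhds.congr' ?_
      obtain ⟨M₀, hM₀⟩ := exists_nat_ge (G y)
      filter_upwards [eventually_ge_atTop M₀] with M hM
      exact (min_eq_left (hM₀.trans (by exact_mod_cast hM))).symm
  obtain ⟨M, hM⟩ := (htrunc.eventually_const_lt ha).exists
  let g : BoundedContinuousFunction Y ℝ :=
    BoundedContinuousFunction.ofNormedAddCommGroup (fun y => min (G y) (M : ℝ))
      (hG.min continuous_const) M fun y => by
        rw [Real.norm_of_nonneg (le_min (hG0 y) M.cast_nonneg)]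
        exact min_le_right _ _
  have hg := ProbabilityMeasure.tendsto_iff_forall_integral_tendsto.1 hμ g
  filter_upwards [hg.eventually_const_lt hM] with i hi
  exact hi.trans_le (integral_mono (g.integrable _) (hGμ i) fun y => min_le_left _ _)

/-- Weak convergence passes to the integral of a continuous function that is dominated by a
continuous function whose integrals converge: semicontinuity is applied to `h + F` and `h - F`. -/
theorem tendsto_integral_of_dominated {Y ι : Type*} [TopologicalSpace Y] [MeasurableSpace Y]
    [OpensMeasurableSpace Y] {l : Filter ι} {μ : ι → ProbabilityMeasure Y}
    {ν : ProbabilityMeasure Y} (hμ : Tendsto μ l (𝓝 ν)) {F h : Y → ℝ} (hF : Continuous F)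
    (hh : Continuous h) (hFh : ∀ y, |F y| ≤ h y) (hhμ : ∀ i, Integrable h (μ i : Measure Y))
    (hhν : Integrable h (ν : Measure Y))
    (hlim : Tendsto (fun i => ∫ y, h y ∂(μ i : Measure Y)) l (𝓝 (∫ y, h y ∂(ν : Measure Y)))) :
    Tendsto (fun i => ∫ y, F y ∂(μ i : Measure Y)) l (𝓝 (∫ y, F y ∂(ν : Measure Y))) := by
  have hint : ∀ ξ : ProbabilityMeasure Y, Integrable h (ξ : Measure Y) →
      Integrable F (ξ : Measure Y) := fun ξ hξ =>
    hξ.mono' hF.measurable.aestronglyMeasurable (Eventually.of_forall hFh)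
  have key : ∀ H : Y → ℝ, Continuous H → (∀ y, |H y| ≤ h y) →
      (∀ i, Integrable H (μ i : Measure Y)) → Integrable H (ν : Measure Y) →
      ∀ a < ∫ y, H y ∂(ν : Measure Y), ∀ᶠ i in l, a < ∫ y, H y ∂(μ i : Measure Y) := by
    intro H hH hHh hHμ hHν a ha
    set ε := (∫ y, H y ∂(ν : Measure Y)) - a with hε
    have hsum : (∫ y, (h y + H y) ∂(ν : Measure Y))
        = (∫ y, h y ∂(ν : Measure Y)) + ∫ y, H y ∂(ν : Measure Y) := integral_add hhν hHν
    have h1 := eventually_lt_integral_of_tendsto hμ (hh.add hH)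
      (fun y => by have := neg_abs_le (H y); have := hHh y; simp only [Pi.add_apply]; linarith)
      (fun i => (hhμ i).add (hHμ i)) (hhν.add hHν)
      (a := (∫ y, (h y + H y) ∂(ν : Measure Y)) - ε / 2) (by simp only [Pi.add_apply]; linarith)
    have h2 := hlim.eventually_lt_const
      (u := (∫ y, h y ∂(ν : Measure Y)) + ε / 2) (by linarith)
    filter_upwards [h1, h2] with i hi1 hi2
    have hi : (∫ y, (h + H) y ∂(μ i : Measure Y))
        = (∫ y, h y ∂(μ i : Measure Y)) + ∫ y, H y ∂(μ i : Measure Y) :=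
      integral_add (hhμ i) (hHμ i)
    linarith
  rw [tendsto_order]
  refine ⟨key F hF hFh (fun i => hint _ (hhμ i)) (hint _ hhν), fun a ha => ?_⟩
  have := key (fun y => -F y) hF.neg (fun y => by rw [abs_neg]; exact hFh y)
    (fun i => (hint _ (hhμ i)).neg) (hint _ hhν).neg (-a) (by rw [integral_neg]; linarith)
  filter_upwards [this] with i hi
  rw [integral_neg] at hi
  linarith

theorem integral_diracProba_prod {T Y : Type*} [TopologicalSpace T] [MeasurableSpace T]
    [BorelSpace T] [SecondCountableTopology T] [TopologicalSpace Y] [MeasurableSpace Y]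
    [BorelSpace Y] [SecondCountableTopology Y] (p : T) (μ : ProbabilityMeasure Y) {G : T × Y → ℝ}
    (hG : Continuous G) :
    ∫ z, G z ∂((diracProba p).prod μ : Measure (T × Y)) = ∫ y, G (p, y) ∂(μ : Measure Y) := by
  have : ((diracProba p).prod μ : Measure (T × Y)) = Measure.map (Prod.mk p) (μ : Measure Y) := by
    rw [ProbabilityMeasure.toMeasure_prod]
    exact Measure.dirac_prod p
  rw [this, integral_map measurable_prodMk_left.aemeasurable hG.measurable.aestronglyMeasurable]

theorem integrable_snd_diracProba_prod {T Y : Type*} [MeasurableSpace T] [MeasurableSpace Y]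
    (p : T) (μ : ProbabilityMeasure Y) {h : Y → ℝ} (hh : Integrable h (μ : Measure Y)) :
    Integrable (fun z : T × Y => h z.2) ((diracProba p).prod μ : Measure (T × Y)) := by
  rw [ProbabilityMeasure.toMeasure_prod]
  exact hh.comp_snd _

/-- A family `F p`, `p ∈ K`, of real functions that is jointly continuous on `K × Y` and has a
common continuous bound `h`, integrable for all measures involved, whose integrals converge
along `l`. -/
structure IsDominatedFamily {T Y ι : Type*} [TopologicalSpace T] [TopologicalSpace Y]
    [MeasurableSpace Y] (K : Set T) (F : T → Y → ℝ) (μ : ι → ProbabilityMeasure Y)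
    (l : Filter ι) (ν : ProbabilityMeasure Y) : Prop where
  continuousOn : ContinuousOn (Function.uncurry F) (K ×ˢ univ)
  dominated : ∃ h : Y → ℝ, Continuous h ∧ (∀ p ∈ K, ∀ y, |F p y| ≤ h y) ∧
    Integrable h (ν : Measure Y) ∧ (∀ i, Integrable h (μ i : Measure Y)) ∧
    Tendsto (fun i => ∫ y, h y ∂(μ i : Measure Y)) l (𝓝 (∫ y, h y ∂(ν : Measure Y)))

theorem IsDominatedFamily.comp {T Y ι κ : Type*} [TopologicalSpace T] [TopologicalSpace Y]
    [MeasurableSpace Y] {K : Set T} {F : T → Y → ℝ} {μ : ι → ProbabilityMeasure Y}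
    {l : Filter ι} {ν : ProbabilityMeasure Y} (hF : IsDominatedFamily K F μ l ν) {l' : Filter κ}
    {φ : κ → ι} (hφ : Tendsto φ l' l) : IsDominatedFamily K F (fun i => μ (φ i)) l' ν := by
  obtain ⟨h, hh, hb, hν, hμ, hlim⟩ := hF.dominated
  exact ⟨hF.continuousOn, h, hh, hb, hν, fun i => hμ (φ i), hlim.comp hφ⟩

theorem IsDominatedFamily.integrable {T Y ι : Type*} [TopologicalSpace T] [TopologicalSpace Y]
    [MeasurableSpace Y] [OpensMeasurableSpace Y] {K : Set T} {F : T → Y → ℝ}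
    {μ : ι → ProbabilityMeasure Y} {l : Filter ι} {ν : ProbabilityMeasure Y}
    (hF : IsDominatedFamily K F μ l ν) {p : T} (hp : p ∈ K) :
    Integrable (F p) (ν : Measure Y) ∧ ∀ i, Integrable (F p) (μ i : Measure Y) := by
  obtain ⟨h, hh, hb, hν, hμ, -⟩ := hF.dominated
  have hc : Continuous (F p) :=
    hF.continuousOn.comp_continuous (Continuous.prodMk_right p) fun y => ⟨hp, mem_univ _⟩
  have : ∀ ξ : ProbabilityMeasure Y, Integrable h (ξ : Measure Y) →
      Integrable (F p) (ξ : Measure Y) := fun ξ hξ =>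
    hξ.mono' hc.measurable.aestronglyMeasurable (Eventually.of_forall (hb p hp))
  exact ⟨this _ hν, fun i => this _ (hμ i)⟩

/-- Joint continuity of `(p, ξ) ↦ ∫ F p dξ`: with `δ_p` the Dirac measure at `p`, this is the
integral of the single function `F` with respect to `δ_p ⊗ ξ`, which depends weakly continuously
on `(p, ξ)`. -/
theorem IsDominatedFamily.tendsto_integral {T Y ι : Type*} [TopologicalSpace T]
    [MeasurableSpace T] [BorelSpace T] [SecondCountableTopology T]
    [TopologicalSpace.PseudoMetrizableSpace T] [TopologicalSpace Y] [MeasurableSpace Y]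
    [BorelSpace Y] [SecondCountableTopology Y] [TopologicalSpace.PseudoMetrizableSpace Y]
    {K : Set T} {F : T → Y → ℝ} {μ : ι → ProbabilityMeasure Y}
    {l : Filter ι} {ν : ProbabilityMeasure Y} (hF : IsDominatedFamily K F μ l ν)
    (hμ : Tendsto μ l (𝓝 ν)) {p : ι → T} {q : T} (hq : q ∈ K) (hp : Tendsto p l (𝓝 q))
    (hpK : ∀ᶠ i in l, p i ∈ K) :
    Tendsto (fun i => ∫ y, F (p i) y ∂(μ i : Measure Y)) l (𝓝 (∫ y, F q y ∂(ν : Measure Y))) := by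
  classical
  obtain ⟨h, hh, hb, hhν, hhμ, hlim⟩ := hF.dominated
  let r : ι → K := fun i => if hi : p i ∈ K then ⟨p i, hi⟩ else ⟨q, hq⟩
  have hrp : ∀ᶠ i in l, (r i : T) = p i := by
    filter_upwards [hpK] with i hi
    simp only [r, dif_pos hi]
  have hr : Tendsto r l (𝓝 ⟨q, hq⟩) := by
    rw [tendsto_subtype_rng]
    exact hp.congr' (hrp.mono fun i hi => hi.symm)
  have hprod : Tendsto (fun i => (diracProba (r i)).prod (μ i)) l
      (𝓝 ((diracProba (⟨q, hq⟩ : K)).prod ν)) :=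
    (ProbabilityMeasure.continuous_prod.tendsto (diracProba (⟨q, hq⟩ : K), ν)).comp
      (((continuous_diracProba.tendsto _).comp hr).prodMk_nhds hμ)
  have hG : Continuous fun z : K × Y => F z.1 z.2 :=
    hF.continuousOn.comp_continuous (f := fun z : K × Y => ((z.1 : T), z.2)) (by fun_prop)
      fun z => ⟨z.1.2, mem_univ _⟩
  have hh' : Continuous fun z : K × Y => h z.2 := hh.comp continuous_snd
  have := tendsto_integral_of_dominated hprod hG hh' (fun z => hb z.1 z.1.2 z.2)
    (fun i => integrable_snd_diracProba_prod _ _ (hhμ i))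
    (integrable_snd_diracProba_prod _ _ hhν)
    (by simpa only [integral_diracProba_prod _ _ hh'] using hlim)
  simp only [integral_diracProba_prod _ _ hG] at this
  refine this.congr' ?_
  filter_upwards [hrp] with i hi
  simp only [hi]

/-- The vector-valued form of `IsDominatedFamily.tendsto_integral`. -/
theorem tendsto_integral_of_isDominatedFamily {T Y ι : Type*} [TopologicalSpace T]
    [MeasurableSpace T] [BorelSpace T] [SecondCountableTopology T]
    [TopologicalSpace.PseudoMetrizableSpace T] [TopologicalSpace Y] [MeasurableSpace Y]
    [BorelSpace Y] [SecondCountableTopology Y] [TopologicalSpace.PseudoMetrizableSpace Y]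
    {d : ℕ} {K : Set T} {F : T → Y → Euc d} {μ : ι → ProbabilityMeasure Y}
    {l : Filter ι} {ν : ProbabilityMeasure Y}
    (hF : ∀ a, IsDominatedFamily K (fun p y => F p y a) μ l ν)
    (hμ : Tendsto μ l (𝓝 ν)) {p : ι → T} {q : T} (hq : q ∈ K) (hp : Tendsto p l (𝓝 q))
    (hpK : ∀ᶠ i in l, p i ∈ K) :
    Tendsto (fun i => ∫ y, F (p i) y ∂(μ i : Measure Y)) l (𝓝 (∫ y, F q y ∂(ν : Measure Y))) := by
  have hcoord : Tendsto (fun i => WithLp.ofLp (∫ y, F (p i) y ∂(μ i : Measure Y))) l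
      (𝓝 (WithLp.ofLp (∫ y, F q y ∂(ν : Measure Y)))) := by
    rw [tendsto_pi_nhds]
    intro a
    rw [eval_integral_piLp (fun b => ((hF b).integrable hq).1) a]
    refine ((hF a).tendsto_integral hμ hq hp hpK).congr' ?_
    filter_upwards [hpK] with i hi
    rw [eval_integral_piLp (fun b => ((hF b).integrable hi).2 i) a]
  exact ((PiLp.continuous_toLp 2 _).tendsto _).comp hcoord

/-! ### Families with a common modulus of continuity -/

theorem IsModulus.exists_forall_le {w : ℝ≥0 → ℝ≥0} (hw : IsModulus w) {ε : ℝ≥0} (hε : 0 < ε) :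
    ∃ δ : ℝ≥0, 0 < δ ∧ ∀ t ≤ δ, w t ≤ ε := by
  have h : ∀ᶠ t in 𝓝[>] (0 : ℝ≥0), w t < ε := hw.2.eventually_lt_const hε
  obtain ⟨δ, hδ, hsub⟩ := mem_nhdsGT_iff_exists_Ioc_subset.1 h
  refine ⟨δ, hδ, fun t ht => ?_⟩
  rcases eq_or_ne t 0 with rfl | ht0
  · rw [hw.1]; exact hε.le
  · exact (hsub ⟨pos_iff_ne_zero.2 ht0, ht⟩ : w t < ε).le

/-- A function on a convex set that varies by at most one over distances up to `δ` grows at most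
linearly: a segment is cut into pieces of length at most `δ`. -/
theorem Convex.abs_sub_le_of_forall_norm_sub_le {E : Type*} [NormedAddCommGroup E]
    [NormedSpace ℝ E] {D : Set E} (hD : Convex ℝ D) {g : E → ℝ} {δ : ℝ} (hδ : 0 < δ)
    (hg : ∀ x ∈ D, ∀ x' ∈ D, ‖x - x'‖ ≤ δ → |g x - g x'| ≤ 1) {x x' : E} (hx : x ∈ D)
    (hx' : x' ∈ D) : |g x - g x'| ≤ ‖x - x'‖ / δ + 1 := by
  set n : ℕ := ⌊‖x - x'‖ / δ⌋₊ + 1 with hn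
  have hn0 : (0 : ℝ) < n := by positivity
  have hnδ : ‖x - x'‖ / n ≤ δ := by
    rw [div_le_iff₀ hn0, mul_comm, ← div_le_iff₀ hδ]
    exact_mod_cast (Nat.lt_floor_add_one _).le
  let z : ℕ → E := fun i => x' + ((i : ℝ) / n) • (x - x')
  have hz : ∀ i ≤ n, z i ∈ D := fun i hi =>
    hD.add_smul_sub_mem hx' hx ⟨by positivity, (div_le_one hn0).2 (by exact_mod_cast hi)⟩
  have hstep : ∀ i, ‖z (i + 1) - z i‖ ≤ δ := by
    intro i
    have : z (i + 1) - z i = (1 / (n : ℝ)) • (x - x') := by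
      simp only [z, add_sub_add_left_eq_sub, ← sub_smul]
      congr 1
      push_cast
      ring
    rw [this, norm_smul, Real.norm_of_nonneg (by positivity), one_div_mul_eq_div]
    exact hnδ
  have hsum : ∀ i ≤ n, |g (z i) - g (z 0)| ≤ i := by
    intro i
    induction i with
    | zero => simp
    | succ i ih =>
      intro hi
      have h1 := hg _ (hz _ hi) _ (hz i (by omega)) (hstep i)
      have h2 := abs_sub_le (g (z (i + 1))) (g (z i)) (g (z 0))
      have h3 := ih (by omega)
      push_cast
      linarith
  have hzn : z n = x := by simp [z]
  have hz0 : z 0 = x' := by simp [z]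
  have h := hsum n le_rfl
  rw [hzn, hz0] at h
  refine h.trans ?_
  rw [hn]
  push_cast
  linarith [Nat.floor_le (show 0 ≤ ‖x - x'‖ / δ by positivity)]

theorem continuousOn_uncurry_of_modulus {T E : Type*} [TopologicalSpace T]
    [NormedAddCommGroup E] {X : Set E} {K : Set T} {F : T → E → ℝ} {w : ℝ≥0 → ℝ≥0}
    (hw : IsModulus w) (hF : ∀ x ∈ X, ContinuousOn (fun p => F p x) K)
    (hmod : ∀ p ∈ K, ∀ x ∈ X, ∀ x' ∈ X, |F p x - F p x'| ≤ w ‖x - x'‖₊) :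
    ContinuousOn (Function.uncurry fun (p : T) (x : X) => F p x) (K ×ˢ univ) := by
  rintro ⟨q, y⟩ ⟨hq, -⟩
  rw [ContinuousWithinAt, Metric.tendsto_nhds]
  intro ε hε
  obtain ⟨δ, hδ, hwδ⟩ := hw.exists_forall_le (ε := (ε / 4).toNNReal) (by simpa using hε)
  have h1 : ∀ᶠ z : T × X in 𝓝[K ×ˢ univ] (q, y), dist (F z.1 y) (F q y) < ε / 2 := by
    have hfst : Tendsto (fun z : T × X => z.1) (𝓝[K ×ˢ univ] (q, y)) (𝓝[K] q) :=
      tendsto_nhdsWithin_iff.2 ⟨(continuous_fst.tendsto (q, y)).mono_left nhdsWithin_le_nhds,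
        eventually_nhdsWithin_of_forall fun z hz => hz.1⟩
    exact (((hF y y.2) q hq).tendsto.comp hfst).eventually (Metric.ball_mem_nhds _ (by linarith))
  have h2 : ∀ᶠ z : T × X in 𝓝[K ×ˢ univ] (q, y), dist z.2 y < δ :=
    ((continuous_snd.tendsto (q, y)).mono_left nhdsWithin_le_nhds).eventually
      (Metric.ball_mem_nhds _ hδ)
  filter_upwards [h1, h2, self_mem_nhdsWithin] with z hz1 hz2 hz
  have h3 : |F z.1 z.2 - F z.1 y| ≤ ε / 4 := by
    refine (hmod z.1 hz.1 z.2 z.2.2 y y.2).trans ?_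
    have : w ‖(z.2 : E) - y‖₊ ≤ (ε / 4).toNNReal := hwδ _ (by
      rw [← NNReal.coe_le_coe, coe_nnnorm, ← dist_eq_norm]
      exact hz2.le)
    calc (w ‖(z.2 : E) - y‖₊ : ℝ) ≤ ((ε / 4).toNNReal : ℝ) := by exact_mod_cast this
      _ = ε / 4 := Real.coe_toNNReal _ (by positivity)
  rw [Real.dist_eq] at hz1
  rw [Real.dist_eq]
  have := abs_sub_le (F z.1 z.2) (F z.1 y) (F q y)
  change |F z.1 z.2 - F q y| < ε
  linarith

theorem isModulus_id : IsModulus fun t => t :=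
  ⟨rfl, tendsto_id.mono_left nhdsWithin_le_nhds⟩

theorem isDominatedFamily_of_boundedLipschitz {T ι : Type*} [TopologicalSpace T] {m : ℕ}
    {X : Set (Euc m)} {K : Set T} {F : T → Euc m → ℝ}
    (hF : ∀ x ∈ X, ContinuousOn (fun p => F p x) K)
    (hlip : ∀ p ∈ K, (fun x : closedHull X => F p x) ∈ boundedLipschitzClass X)
    (μ : ι → ProbabilityMeasure X) (l : Filter ι) (ν : ProbabilityMeasure X) :
    IsDominatedFamily K (fun p (x : X) => F p x) μ l ν := by
  have hX : X ⊆ closedHull X := (subset_convexHull ℝ X).trans subset_closure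
  refine ⟨continuousOn_uncurry_of_modulus isModulus_id hF fun p hp x hx x' hx' =>
    (hlip p hp).1 ⟨x, hX hx⟩ ⟨x', hX hx'⟩, fun _ => 1, continuous_const,
    fun p hp x => (hlip p hp).2 ⟨x, hX x.2⟩, integrable_const _, fun _ => integrable_const _, ?_⟩
  simpa using tendsto_const_nhds

/-- The domination comes from the linear growth of functions with a modulus of continuity on a
convex set. Compactness of the parameter set makes the growth uniform. -/
theorem isDominatedFamily_of_modulus {T ι : Type*} [TopologicalSpace T] {m : ℕ}
    {X : Set (Euc m)} {K : Set T} (hK : IsCompact K) {F : T → Euc m → ℝ}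
    (hF : ∀ x ∈ X, ContinuousOn (fun p => F p x) K) {w : ℝ≥0 → ℝ≥0} (hw : IsModulus w)
    (hmod : ∀ p ∈ K, (fun x : closedHull X => F p x) ∈ modulusClass X w)
    {μ : ι → ProbabilityMeasure X} {l : Filter ι} {ν : ProbabilityMeasure X}
    (hν : Integrable (fun x : X => ‖(x : Euc m)‖) (ν : Measure X))
    (hμ : ∀ i, Integrable (fun x : X => ‖(x : Euc m)‖) (μ i : Measure X))
    (hlim : Tendsto (fun i => ∫ x : X, ‖(x : Euc m)‖ ∂(μ i : Measure X)) l
      (𝓝 (∫ x : X, ‖(x : Euc m)‖ ∂(ν : Measure X)))) :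
    IsDominatedFamily K (fun p (x : X) => F p x) μ l ν := by
  have hX : X ⊆ closedHull X := (subset_convexHull ℝ X).trans subset_closure
  obtain ⟨x₀⟩ := ν.nonempty
  obtain ⟨δ, hδ, hwδ⟩ := hw.exists_forall_le one_pos
  obtain ⟨M, hM⟩ := hK.exists_bound_of_continuousOn (hF x₀ x₀.2)
  let A : ℝ := M + 1 + ‖(x₀ : Euc m)‖ / δ
  have hint : ∀ ξ : ProbabilityMeasure X,
      Integrable (fun x : X => ‖(x : Euc m)‖) (ξ : Measure X) →
      Integrable (fun x : X => A + ‖(x : Euc m)‖ / δ) (ξ : Measure X) := fun ξ hξ =>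
    (integrable_const A).add (hξ.div_const (δ : ℝ))
  have hval : ∀ ξ : ProbabilityMeasure X,
      Integrable (fun x : X => ‖(x : Euc m)‖) (ξ : Measure X) →
      ∫ x : X, (A + ‖(x : Euc m)‖ / δ) ∂(ξ : Measure X)
        = A + (∫ x : X, ‖(x : Euc m)‖ ∂(ξ : Measure X)) / δ := by
    intro ξ hξ
    rw [integral_add (integrable_const A) (hξ.div_const (δ : ℝ)), integral_div]
    simp
  refine ⟨continuousOn_uncurry_of_modulus hw hF fun p hp x hx x' hx' =>
    hmod p hp ⟨x, hX hx⟩ ⟨x', hX hx'⟩, fun x => A + ‖(x : Euc m)‖ / δ, by fun_prop,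
    fun p hp x => ?_, hint _ hν, fun i => hint _ (hμ i), ?_⟩
  · have h1 : |F p x - F p x₀| ≤ ‖(x : Euc m) - x₀‖ / δ + 1 := by
      refine (convex_convexHull ℝ X).closure.abs_sub_le_of_forall_norm_sub_le hδ ?_
        (hX x.2) (hX x₀.2)
      intro y hy y' hy' hyy
      refine (hmod p hp ⟨y, hy⟩ ⟨y', hy'⟩).trans ?_
      exact_mod_cast hwδ _ hyy
    have h2 : |F p x₀| ≤ M := hM p hp
    have h3 : ‖(x : Euc m) - x₀‖ / δ ≤ ‖(x : Euc m)‖ / δ + ‖(x₀ : Euc m)‖ / δ := by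
      rw [← add_div]
      gcongr
      exact norm_sub_le _ _
    have h4 := abs_sub_abs_le_abs_sub (F p x) (F p x₀)
    simp only [A]
    linarith
  · simp only [hval _ hν, fun i => hval _ (hμ i)]
    exact (hlim.div_const _).const_add A

/-! ### Continuous convergence of the composite functional -/

namespace CompositeProblem

variable {n m k : ℕ} (C : CompositeProblem n m k)

@[simp]
theorem levelValue_last (Q : Fin (k + 1) → ProbabilityMeasure C.X) (u : Euc n) :
    C.levelValue Q u (Fin.last k) = C.fBarLast (Q (Fin.last k)) u := by
  simp [levelValue]

@[simp]
theorem levelValue_castSucc (Q : Fin (k + 1) → ProbabilityMeasure C.X) (u : Euc n) (j : Fin k) :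
    C.levelValue Q u j.castSucc = C.fBar j (Q j.castSucc) u (C.levelValue Q u j.succ) := by
  simp [levelValue]

/-- All components of all levels are dominated families over the localized parameter sets. -/
structure HasDominatedLevels {ι : Type*} (Uc : Set (Euc n))
    (I : (j : Fin (k + 1)) → Set (Euc (C.dim j))) (Q : ι → Fin (k + 1) → ProbabilityMeasure C.X)
    (l : Filter ι) (P : ProbabilityMeasure C.X) : Prop where
  f : ∀ (j : Fin k) (a : Fin (C.dim j.castSucc)),
    IsDominatedFamily (Uc ×ˢ I j.succ)
      (fun (p : Euc n × Euc (C.dim j.succ)) (x : C.X) => C.f j p.1 p.2 x a)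
      (fun i => Q i j.castSucc) l P
  fLast : ∀ a : Fin (C.dim (Fin.last k)),
    IsDominatedFamily Uc (fun (u : Euc n) (x : C.X) => C.fLast u x a)
      (fun i => Q i (Fin.last k)) l P

variable {C} {P : ProbabilityMeasure C.X} {Uc : Set (Euc n)}
  {I : (j : Fin (k + 1)) → Set (Euc (C.dim j))}

theorem HasDominatedLevels.comp {ι κ : Type*} {Q : ι → Fin (k + 1) → ProbabilityMeasure C.X}
    {l : Filter ι} (h : C.HasDominatedLevels Uc I Q l P) {l' : Filter κ} {φ : κ → ι}
    (hφ : Tendsto φ l' l) : C.HasDominatedLevels Uc I (fun i => Q (φ i)) l' P :=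
  ⟨fun j a => (h.f j a).comp hφ, fun a => (h.fLast a).comp hφ⟩

theorem hasDominatedLevels_of_boundedLipschitzCondition {ι : Type*}
    (hC : C.StandingAssumptions P) (hcond : C.BoundedLipschitzCondition Uc I)
    (Q : ι → Fin (k + 1) → ProbabilityMeasure C.X) (l : Filter ι) :
    C.HasDominatedLevels Uc I Q l P := by
  refine ⟨fun j a => ?_, fun a => ?_⟩
  · refine isDominatedFamily_of_boundedLipschitz
      (F := fun (p : Euc n × Euc (C.dim j.succ)) x => C.f j p.1 p.2 x a) (fun x hx => ?_)
      (fun p hp => hcond.1 j p.1 hp.1 p.2 hp.2 a) _ _ _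
    have := hC.continuous_f j x hx
    fun_prop
  · refine isDominatedFamily_of_boundedLipschitz
      (F := fun (u : Euc n) x => C.fLast u x a) (fun x hx => ?_)
      (fun u hu => hcond.2 u hu a) _ _ _
    have := hC.continuous_fLast x hx
    fun_prop

theorem hasDominatedLevels_of_modulusCondition (hC : C.StandingAssumptions P)
    (hloc : C.IsLocalization P Uc I) {w : (j : Fin (k + 1)) → Fin (C.dim j) → ℝ≥0 → ℝ≥0}
    (hw : ∀ j i, IsModulus (w j i)) (hcond : C.ModulusCondition Uc I w)
    {Q : ℕ → Fin (k + 1) → ProbabilityMeasure C.X} (hmom : C.FirstMomentsConverge P Q) :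
    C.HasDominatedLevels Uc I Q atTop P := by
  obtain ⟨hP, hQ, hlim⟩ := hmom
  refine ⟨fun j a => ?_, fun a => ?_⟩
  · refine isDominatedFamily_of_modulus
      (hloc.isCompact.prod (hloc.isCompact_I j.succ (Fin.succ_ne_zero j)))
      (F := fun (p : Euc n × Euc (C.dim j.succ)) x => C.f j p.1 p.2 x a) (fun x hx => ?_)
      (hw j.castSucc a) (fun p hp => hcond.1 j p.1 hp.1 p.2 hp.2 a) hP (fun N => hQ N _) (hlim _)
    have := hC.continuous_f j x hx
    fun_prop
  · refine isDominatedFamily_of_modulus hloc.isCompact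
      (F := fun (u : Euc n) x => C.fLast u x a) (fun x hx => ?_)
      (hw (Fin.last k) a) (fun u hu => hcond.2 u hu a) hP (fun N => hQ N _) (hlim _)
    have := hC.continuous_fLast x hx
    fun_prop

theorem IsLocalization.levelValue_mem_interior (hloc : C.IsLocalization P Uc I) {u : Euc n}
    (hu : u ∈ Uc) (j : Fin (k + 1)) (hj : j ≠ 0) :
    C.levelValue (fun _ => P) u j ∈ interior (I j) := by
  induction j using Fin.reverseInduction with
  | last => simpa using hloc.fBarLast_mem hj u hu
  | cast j ih =>
    simpa using hloc.fBar_mem j hj u hu _ (interior_subset (ih (Fin.succ_ne_zero j)))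

/-- The limit of the inner level lies in the interior of `I (j + 1)`, so the approximations are
eventually in `I (j + 1)`, where the next outer level is controlled. -/
theorem tendsto_levelValue {ι : Type*} {Q : ι → Fin (k + 1) → ProbabilityMeasure C.X}
    {l : Filter ι} (hloc : C.IsLocalization P Uc I) (hdom : C.HasDominatedLevels Uc I Q l P)
    (hQ : ∀ j, Tendsto (fun i => Q i j) l (𝓝 P)) {v : ι → Euc n} {u : Euc n} (hu : u ∈ Uc)
    (hv : Tendsto v l (𝓝 u)) (hvU : ∀ᶠ i in l, v i ∈ Uc) (j : Fin (k + 1)) :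
    Tendsto (fun i => C.levelValue (Q i) (v i) j) l (𝓝 (C.levelValue (fun _ => P) u j)) := by
  induction j using Fin.reverseInduction with
  | last =>
    simp only [levelValue_last]
    exact tendsto_integral_of_isDominatedFamily (F := fun u (x : C.X) => C.fLast u x)
      hdom.fLast (hQ _) hu hv hvU
  | cast j ih =>
    simp only [levelValue_castSucc]
    have hmem := hloc.levelValue_mem_interior hu j.succ (Fin.succ_ne_zero j)
    refine tendsto_integral_of_isDominatedFamily
      (F := fun (p : Euc n × Euc (C.dim j.succ)) (x : C.X) => C.f j p.1 p.2 x)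
      (p := fun i => (v i, C.levelValue (Q i) (v i) j.succ))
      (q := (u, C.levelValue (fun _ => P) u j.succ))
      (hdom.f j) (hQ _) ⟨hu, interior_subset hmem⟩ (hv.prodMk_nhds ih) ?_
    filter_upwards [hvU, ih.eventually (mem_interior_iff_mem_nhds.1 hmem)] with i h1 h2
    exact ⟨h1, h2⟩

/-- Continuous convergence of `ϱ^{𝐐_N}` to `ϱ` on `𝒰`. -/
theorem tendsto_rho_prod {ι : Type*} {Q : ι → Fin (k + 1) → ProbabilityMeasure C.X}
    {l : Filter ι} (hloc : C.IsLocalization P Uc I) (hdom : C.HasDominatedLevels Uc I Q l P)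
    (hQ : ∀ j, Tendsto (fun i => Q i j) l (𝓝 P)) {u : Euc n} (hu : u ∈ Uc) :
    Tendsto (fun z : ι × Euc n => C.rho (Q z.1) z.2) (l ×ˢ 𝓝[Uc] u)
      (𝓝 (C.rho (fun _ => P) u)) := by
  have hsnd : Tendsto (fun z : ι × Euc n => z.2) (l ×ˢ 𝓝[Uc] u) (𝓝[Uc] u) := tendsto_snd
  have := tendsto_levelValue hloc (hdom.comp (tendsto_fst (g := 𝓝[Uc] u)))
    (fun j => (hQ j).comp tendsto_fst) hu (tendsto_nhds_of_tendsto_nhdsWithin hsnd)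
    (eventually_mem_of_tendsto_nhdsWithin hsnd) 0
  exact ((EuclideanSpace.proj (𝕜 := ℝ)
    (⟨0, by rw [C.dim_zero]; exact Nat.one_pos⟩ : Fin (C.dim 0))).continuous.tendsto _).comp this

end CompositeProblem

/-! ### Stability of optimal values and solution sets -/

/-- A property that holds eventually near each point of a compact set holds eventually on the
whole set. -/
theorem IsCompact.eventually_forall_mem_of_prod_nhdsWithin {X ι : Type*} [TopologicalSpace X]
    {K : Set X} (hK : IsCompact K) {l : Filter ι} {p : ι → X → Prop}
    (hp : ∀ x ∈ K, ∀ᶠ z : ι × X in l ×ˢ 𝓝[K] x, p z.1 z.2) : ∀ᶠ i in l, ∀ x ∈ K, p i x := by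
  refine hK.induction_on (p := fun s => ∀ᶠ i in l, ∀ x ∈ s, p i x) (by simp)
    (fun s t hst ht => ht.mono fun i hi x hx => hi x (hst hx)) (fun s t hs ht => ?_)
    fun x hx => ?_
  · filter_upwards [hs, ht] with i his hit x hx
    exact hx.elim (his x) (hit x)
  · obtain ⟨a, ha, b, hb, hab⟩ := eventually_prod_iff.1 (hp x hx)
    exact ⟨{y | b y}, hb, ha.mono fun i hi y hy => hab hi hy⟩

theorem oneSidedDist_le_iff {n : ℕ} {A B : Set (Euc n)} {ε : ℝ≥0∞} :
    oneSidedDist A B ≤ ε ↔ ∀ x ∈ A, Metric.infEDist x B ≤ ε := by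
  simp only [oneSidedDist, iSup_le_iff, Metric.infEDist]

theorem oneSidedDist_singleton_le {n : ℕ} {A : Set (Euc n)} (hA : A.Nonempty) (u : Euc n) :
    oneSidedDist {u} A ≤ oneSidedDist A {u} := by
  obtain ⟨a, ha⟩ := hA
  refine oneSidedDist_le_iff.2 ?_
  rintro _ rfl
  calc Metric.infEDist _ A ≤ edist _ a := Metric.infEDist_le_edist_of_mem ha
    _ = edist a _ := edist_comm _ _
    _ = Metric.infEDist a {_} := Metric.infEDist_singleton.symm
    _ ≤ _ := oneSidedDist_le_iff.1 le_rfl a ha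

namespace CompositeProblem

variable {n m k : ℕ} {C : CompositeProblem n m k} {P : ProbabilityMeasure C.X} {Uc : Set (Euc n)}

theorem optimalValue_eq_rho {Q : Fin (k + 1) → ProbabilityMeasure C.X} {u : Euc n}
    (hu : u ∈ C.solutionSet Q) : C.optimalValue Q = C.rho Q u :=
  le_antisymm ((C.optimalValue_isLeast Q ⟨u, hu⟩).2 ⟨u, hu.1, rfl⟩) (by
    obtain ⟨v, hv, hveq⟩ := (C.optimalValue_isLeast Q ⟨u, hu⟩).1
    exact hveq ▸ hu.2 v hv)

/-- The upper bound comes from the values at a fixed minimizer of the limit problem; the lower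
bound is uniform on the compact set that contains the minimizers of the approximations. -/
theorem tendsto_optimalValue {ι : Type*} {Q : ι → Fin (k + 1) → ProbabilityMeasure C.X}
    {l : Filter ι} (hUc : IsCompact Uc) (hUcU : Uc ⊆ C.U)
    (hne : (C.solutionSet fun _ => P).Nonempty) (hsub : (C.solutionSet fun _ => P) ⊆ Uc)
    (hrho : ∀ u ∈ Uc, Tendsto (fun z : ι × Euc n => C.rho (Q z.1) z.2) (l ×ˢ 𝓝[Uc] u)
      (𝓝 (C.rho (fun _ => P) u)))
    (hpt : ∀ u ∈ Uc, Tendsto (fun i => C.rho (Q i) u) l (𝓝 (C.rho (fun _ => P) u)))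
    (hsol : ∀ᶠ i in l, (C.solutionSet (Q i)).Nonempty ∧ C.solutionSet (Q i) ⊆ Uc) :
    Tendsto (fun i => C.optimalValue (Q i)) l (𝓝 (C.optimalValue fun _ => P)) := by
  obtain ⟨u, hu⟩ := hne
  rw [optimalValue_eq_rho hu, tendsto_order]
  refine ⟨fun a ha => ?_, fun a ha => ?_⟩
  · have hlow := hUc.eventually_forall_mem_of_prod_nhdsWithin (p := fun i v => a < C.rho (Q i) v)
      fun v hv => (hrho v hv).eventually_const_lt (ha.trans_le (hu.2 v (hUcU hv)))
    filter_upwards [hlow, hsol] with i hi ⟨⟨v, hv⟩, hsubi⟩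
    rw [optimalValue_eq_rho hv]
    exact hi v (hsubi hv)
  · filter_upwards [(hpt u (hsub hu)).eventually_lt_const ha, hsol] with i hi hsoli
    exact ((C.optimalValue_isLeast _ hsoli.1).2 ⟨u, hu.1, rfl⟩).trans_lt hi

theorem tendsto_oneSidedDist_solutionSet {ι : Type*}
    {Q : ι → Fin (k + 1) → ProbabilityMeasure C.X}
    {l : Filter ι} (hUc : IsCompact Uc) (hUcU : Uc ⊆ C.U)
    (hne : (C.solutionSet fun _ => P).Nonempty)
    (hrho : ∀ u ∈ Uc, Tendsto (fun z : ι × Euc n => C.rho (Q z.1) z.2) (l ×ˢ 𝓝[Uc] u)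
      (𝓝 (C.rho (fun _ => P) u)))
    (hopt : Tendsto (fun i => C.optimalValue (Q i)) l (𝓝 (C.optimalValue fun _ => P)))
    (hsol : ∀ᶠ i in l, C.solutionSet (Q i) ⊆ Uc) :
    Tendsto (fun i => oneSidedDist (C.solutionSet (Q i)) (C.solutionSet fun _ => P)) l (𝓝 0) := by
  obtain ⟨u, hu⟩ := hne
  rw [ENNReal.tendsto_nhds_zero]
  intro ε hε
  have key := hUc.eventually_forall_mem_of_prod_nhdsWithin (l := l)
    (p := fun i v => v ∈ C.solutionSet (Q i) →
      Metric.infEDist v (C.solutionSet fun _ => P) ≤ ε) fun v hv => ?_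
  · filter_upwards [key, hsol] with i hi hsubi
    exact oneSidedDist_le_iff.2 fun v hv => hi v (hsubi hv) hv
  by_cases hvS : v ∈ C.solutionSet fun _ => P
  · -- Near a solution of the limit problem the distance is small.
    have hball : ∀ᶠ v' in 𝓝[Uc] v, edist v' v < ε :=
      nhdsWithin_le_nhds (Metric.eball_mem_nhds v hε)
    filter_upwards [tendsto_snd.eventually hball] with z hz _
    exact (Metric.infEDist_le_edist_of_mem hvS).trans hz.le
  · -- Near any other point the values stay above the optimal values.
    have hlt : C.optimalValue (fun _ => P) < C.rho (fun _ => P) v := by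
      by_contra hle
      rw [optimalValue_eq_rho hu, not_lt] at hle
      exact hvS ⟨hUcU hv, fun v' hv' => hle.trans (hu.2 v' hv')⟩
    filter_upwards [(hopt.comp tendsto_fst).eventually_lt (hrho v hv) hlt] with z hz hzS
    exact absurd (optimalValue_eq_rho hzS) hz.ne

end CompositeProblem

theorem mainTheorem2 {n m k : ℕ} (C : CompositeProblem n m k) (P : ProbabilityMeasure C.X)
    (hC : C.StandingAssumptions P)
    (Uc : Set (Euc n)) (I : (j : Fin (k + 1)) → Set (Euc (C.dim j)))
    (hloc : C.IsLocalization P Uc I)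
    (w : (j : Fin (k + 1)) → Fin (C.dim j) → ℝ≥0 → ℝ≥0) (hw : ∀ j i, IsModulus (w j i))
    (Q : ℕ → Fin (k + 1) → ProbabilityMeasure C.X)
    -- weak convergence at every level
    (hQ : ∀ j, Tendsto (fun N => Q N j) atTop (𝓝 P))
    -- the approximate problems have solutions for large N, and all of them are in the compact set
    (hsol : ∀ᶠ N in atTop, (C.solutionSet (Q N)).Nonempty ∧ C.solutionSet (Q N) ⊆ Uc)
    (hcond : C.BoundedLipschitzCondition Uc I ∨
      (C.ModulusCondition Uc I w ∧ C.FirstMomentsConverge P Q)) :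
    (∀ u ∈ Uc, Tendsto (fun N => C.rho (Q N) u) atTop (𝓝 (C.rho (fun _ => P) u))) ∧
    Tendsto (fun N => C.optimalValue (Q N)) atTop (𝓝 (C.optimalValue fun _ => P)) ∧
    Tendsto (fun N => oneSidedDist (C.solutionSet (Q N)) (C.solutionSet fun _ => P))
      atTop (𝓝 0) ∧
    ((∃ u, (C.solutionSet fun _ => P) = {u}) →
      Tendsto (fun N => pompeiuHausdorffDist (C.solutionSet (Q N)) (C.solutionSet fun _ => P))
        atTop (𝓝 0)) := by
  have hdom : C.HasDominatedLevels Uc I Q atTop P := by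
    rcases hcond with ha | ⟨hb, hmom⟩
    · exact CompositeProblem.hasDominatedLevels_of_boundedLipschitzCondition hC ha Q atTop
    · exact CompositeProblem.hasDominatedLevels_of_modulusCondition hC hloc hw hb hmom
  have hrho : ∀ u ∈ Uc, Tendsto (fun z : ℕ × Euc n => C.rho (Q z.1) z.2) (atTop ×ˢ 𝓝[Uc] u)
      (𝓝 (C.rho (fun _ => P) u)) :=
    fun u hu => CompositeProblem.tendsto_rho_prod hloc hdom hQ hu
  have hpt : ∀ u ∈ Uc, Tendsto (fun N => C.rho (Q N) u) atTop (𝓝 (C.rho (fun _ => P) u)) :=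
    fun u hu => (hrho u hu).comp
      (tendsto_id.prodMk (tendsto_const_pure.mono_right (pure_le_nhdsWithin hu)))
  have hopt := CompositeProblem.tendsto_optimalValue hloc.isCompact hloc.subset_U
    hC.nonempty_solutionSet hloc.solutionSet_subset hrho hpt hsol
  have hdist := CompositeProblem.tendsto_oneSidedDist_solutionSet hloc.isCompact hloc.subset_U
    hC.nonempty_solutionSet hrho hopt (hsol.mono fun N h => h.2)
  refine ⟨hpt, hopt, hdist, ?_⟩
  rintro ⟨u, hu⟩
  rw [hu] at hdist ⊢
  refine hdist.congr' ?_
  filter_upwards [hsol] with N hN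
  exact (max_eq_left (oneSidedDist_singleton_le hN.1 u)).symm
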